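/- Let $Y\in\mathbb{R}^{m\times n}$ and $\lambda>0$, and let $Y=U_Y\,\mathrm{diag}(\sigma_Y)\,V_Y^T$ be a singular value decomposition of $Y$ (full, thin or compact): the columns of $U_Y\in\mathbb{R}^{m\times p}$ and of $V_Y\in\mathbb{R}^{n\times q}$ are orthonormal, $\sigma_Y\in\mathbb{R}^{\min(p,q)}$ has nonnegative entries, and $\mathrm{diag}(d)$ denotes the $p\times q$ matrix with main diagonal $d$ and zeros elsewhere. Let $\mathcal{P}_{\ell_1}$ denote the Euclidean projection onto the unit ball $\{x:\sum_i|x_i|\le 1\}$ of the $\ell_1$-norm in $\mathbb{R}^{\min(p,q)}$. Then the problem $$\min_{X\in\mathbb{R}^{m\times n}}\ \tfrac12\|Y-X\|_F^2+\lambda\|X\|_2,$$ where $\|\cdot\|_F$ is the Frobenius norm and $\|\cdot\|_2$ the spectral norm (the operator norm induced by the Euclidean norms), has exactly one minimizer, namely $$X^*=U_Y\,\mathrm{diag}\bigl[\sigma_Y-\lambda\,\mathcal{P}_{\ell_1}(\sigma_Y/\lambda)\bigr]\,V_Y^T .$$ -/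

import Mathlib

namespace SpectralProx

open scoped Matrix

open scoped Matrix.Norms.Frobenius in
/-- The Frobenius norm of a real matrix. -/
noncomputable def frobNorm {m n : ℕ} (A : Matrix (Fin m) (Fin n) ℝ) : ℝ := ‖A‖

open scoped Matrix.Norms.L2Operator in
/-- The spectral norm of a real matrix: the operator norm induced by the Euclidean norms. -/
noncomputable def specNorm {m n : ℕ} (A : Matrix (Fin m) (Fin n) ℝ) : ℝ := ‖A‖

/-- The `p × q` matrix (square or not) with main diagonal `d` and zeros elsewhere. -/
def rectDiag {p q : ℕ} (d : EuclideanSpace ℝ (Fin (min p q))) : Matrix (Fin p) (Fin q) ℝ :=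
  Matrix.of fun i j =>
    if h : (i : ℕ) = (j : ℕ) then d ⟨i, lt_min i.isLt (h ▸ j.isLt)⟩ else 0

/-- `Y = U diag(σ) Vᵀ` is a singular value decomposition of `Y`: the columns of `U` and of `V` are
orthonormal and the entries of `σ` are nonnegative. The choice `p = m`, `q = n` gives the full
decomposition, `p = q = min m n` the thin one and `p = q = rank Y` the compact one. The singular
values may be listed in any order. -/
structure IsSVD {m n p q : ℕ} (Y : Matrix (Fin m) (Fin n) ℝ) (U : Matrix (Fin m) (Fin p) ℝ)
    (σ : EuclideanSpace ℝ (Fin (min p q))) (V : Matrix (Fin n) (Fin q) ℝ) : Prop where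
  orthonormal_left : Uᵀ * U = 1
  orthonormal_right : Vᵀ * V = 1
  nonneg : ∀ i, 0 ≤ σ i
  eq_mul : Y = U * rectDiag σ * Vᵀ

/-- The closed unit ball of the `ℓ¹` norm in `ℝʳ`. -/
def l1Ball (r : ℕ) : Set (EuclideanSpace ℝ (Fin r)) := {x | ∑ i, |x i| ≤ 1}

/-- Every point has exactly one nearest point, in the Euclidean norm, in the `ℓ¹` unit ball. -/
theorem existsUnique_l1Proj {r : ℕ} (v : EuclideanSpace ℝ (Fin r)) :
    ∃! x, x ∈ l1Ball r ∧ ∀ y ∈ l1Ball r, ‖v - x‖ ≤ ‖v - y‖ := by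
  have hne : (l1Ball r).Nonempty := ⟨0, by simp [l1Ball]⟩
  have hcl : IsClosed (l1Ball r) := by
    refine isClosed_le ?_ continuous_const
    fun_prop
  have hcv : Convex ℝ (l1Ball r) := by
    intro x hx y hy a b ha hb hab
    simp only [l1Ball, Set.mem_ofPred_eq] at hx hy ⊢
    calc ∑ i, |(a • x + b • y) i| ≤ ∑ i, (a * |x i| + b * |y i|) := by
          refine Finset.sum_le_sum fun i _ => ?_
          have := abs_add_le (a * x i) (b * y i)
          rw [abs_mul, abs_mul, abs_of_nonneg ha, abs_of_nonneg hb] at this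
          simpa using this
      _ = a * ∑ i, |x i| + b * ∑ i, |y i| := by
          rw [Finset.sum_add_distrib, Finset.mul_sum, Finset.mul_sum]
      _ ≤ 1 := by nlinarith
  obtain ⟨x, hx, hmin⟩ := hcl.exists_infDist_eq_dist hne v
  have hx' : ∀ y ∈ l1Ball r, ‖v - x‖ ≤ ‖v - y‖ := fun y hy => by
    rw [← dist_eq_norm, ← dist_eq_norm, ← hmin]
    exact Metric.infDist_le_dist_of_mem hy
  refine ⟨x, ⟨hx, hx'⟩, ?_⟩
  rintro z ⟨hz, hz'⟩
  have hmid := hx' _ (hcv hx hz (by norm_num : (0 : ℝ) ≤ 1 / 2) (by norm_num : (0 : ℝ) ≤ 1 / 2)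
    (by norm_num))
  have heq : ‖v - z‖ = ‖v - x‖ := le_antisymm (hz' x hx) (hx' z hz)
  have hpar := parallelogram_law_with_norm ℝ (v - x) (v - z)
  have h1 : v - x + (v - z) = (2 : ℝ) • (v - ((1 / 2 : ℝ) • x + (1 / 2 : ℝ) • z)) := by
    module
  have h2 : v - x - (v - z) = z - x := by abel
  rw [h1, h2, norm_smul, heq, Real.norm_of_nonneg (by norm_num : (0 : ℝ) ≤ 2)] at hpar
  have h0 : ‖z - x‖ = 0 := by
    have := norm_nonneg (v - x)
    have := norm_nonneg (z - x)
    nlinarith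
  exact sub_eq_zero.mp (norm_eq_zero.mp h0)

/-- Euclidean projection onto the `ℓ¹` unit ball. -/
noncomputable def l1Proj {r : ℕ} (v : EuclideanSpace ℝ (Fin r)) : EuclideanSpace ℝ (Fin r) :=
  (existsUnique_l1Proj v).choose

/-- The objective `½ ‖Y - X‖_F² + lam ‖X‖₂`, as a function of `X`. -/
noncomputable def objective {m n : ℕ} (Y : Matrix (Fin m) (Fin n) ℝ) (lam : ℝ)
    (X : Matrix (Fin m) (Fin n) ℝ) : ℝ :=
  1 / 2 * frobNorm (Y - X) ^ 2 + lam * specNorm X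

end SpectralProx

namespace SpectralProx

open scoped Matrix

variable {m n p q r : ℕ}

/-! Put `d = l1Proj (lam⁻¹ • σ)`, `G = U * rectDiag d * Vᵀ` and let `Z` be the claimed minimizer, so
that `Y - Z = lam • G`. The point is that `G` is a subgradient of the spectral norm at `Z`: `⟨G, X⟩
≤ ‖X‖₂` for all `X` because `d` lies in the ℓ¹ ball (`trace_transpose_mul_le_specNorm`), and `‖Z‖₂ ≤
⟨G, Z⟩` by the variational inequality of the projection (`abs_sub_smul_l1Proj_le`). Expanding the
square around `Z` then gives `objective_add_le`, whose quadratic surplus yields minimality and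
uniqueness together. -/

theorem frobNorm_sq (A : Matrix (Fin m) (Fin n) ℝ) : frobNorm A ^ 2 = (Aᵀ * A).trace := by
  rw [frobNorm, Matrix.frobenius_norm_def, ← Real.sqrt_eq_rpow, Real.sq_sqrt (by positivity),
    Matrix.trace, Finset.sum_comm]
  simp [Matrix.mul_apply, sq]

theorem eq_zero_of_frobNorm_eq_zero {A : Matrix (Fin m) (Fin n) ℝ} (h : frobNorm A = 0) :
    A = 0 := by
  have h' := frobNorm_sq A
  rw [h, zero_pow two_ne_zero, eq_comm, ← Matrix.conjTranspose_eq_transpose_of_trivial] at h'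
  exact Matrix.trace_conjTranspose_mul_self_eq_zero_iff.1 h'

theorem frobNorm_sub_sq (Y X Z : Matrix (Fin m) (Fin n) ℝ) :
    frobNorm (Y - X) ^ 2 =
      frobNorm (Y - Z) ^ 2 + 2 * ((Y - Z)ᵀ * (Z - X)).trace + frobNorm (X - Z) ^ 2 := by
  have hsymm : ((Z - X)ᵀ * (Y - Z)).trace = ((Y - Z)ᵀ * (Z - X)).trace := by
    rw [← Matrix.trace_transpose, Matrix.transpose_mul, Matrix.transpose_transpose]
  have hXZ : (X - Z)ᵀ * (X - Z) = (Z - X)ᵀ * (Z - X) := by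
    rw [← neg_sub Z X, Matrix.transpose_neg, Matrix.neg_mul, Matrix.mul_neg, neg_neg]
  rw [frobNorm_sq, frobNorm_sq, frobNorm_sq, hXZ, ← sub_add_sub_cancel Y Z X,
    Matrix.transpose_add, Matrix.add_mul, Matrix.mul_add, Matrix.mul_add, Matrix.trace_add,
    Matrix.trace_add, Matrix.trace_add, hsymm]
  ring

section SpectralNorm

open scoped Matrix.Norms.L2Operator

theorem specNorm_nonneg (A : Matrix (Fin m) (Fin n) ℝ) : 0 ≤ specNorm A := norm_nonneg A

theorem specNorm_mul_le (A : Matrix (Fin m) (Fin n) ℝ) (B : Matrix (Fin n) (Fin p) ℝ) :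
    specNorm (A * B) ≤ specNorm A * specNorm B := Matrix.l2_opNorm_mul A B

theorem specNorm_transpose (A : Matrix (Fin m) (Fin n) ℝ) : specNorm Aᵀ = specNorm A := by
  rw [← Matrix.conjTranspose_eq_transpose_of_trivial]
  exact Matrix.l2_opNorm_conjTranspose A

theorem specNorm_transpose_mul_self (A : Matrix (Fin m) (Fin n) ℝ) :
    specNorm (Aᵀ * A) = specNorm A * specNorm A := by
  rw [← Matrix.conjTranspose_eq_transpose_of_trivial]
  exact Matrix.l2_opNorm_conjTranspose_mul_self A

theorem specNorm_diagonal_le {d : Fin n → ℝ} {c : ℝ} (hc : 0 ≤ c) (hd : ∀ i, |d i| ≤ c) :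
    specNorm (Matrix.diagonal d) ≤ c :=
  (Matrix.l2_opNorm_diagonal d).trans_le ((pi_norm_le_iff_of_nonneg hc).2 hd)

theorem abs_apply_le_specNorm (A : Matrix (Fin m) (Fin n) ℝ) (i : Fin m) (j : Fin n) :
    |A i j| ≤ specNorm A := by
  have h := Matrix.l2_opNorm_mulVec A (EuclideanSpace.single j 1)
  have h' := (PiLp.norm_apply_le (WithLp.toLp 2 (A *ᵥ (EuclideanSpace.single j (1 : ℝ)).ofLp))
    i).trans h
  simpa [specNorm] using h'

end SpectralNorm

theorem specNorm_le_one_of_transpose_mul_self {U : Matrix (Fin m) (Fin p) ℝ} (hU : Uᵀ * U = 1) :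
    specNorm U ≤ 1 := by
  -- Equality fails for `p = 0`, where the identity has norm `0`.
  have h : specNorm (1 : Matrix (Fin p) (Fin p) ℝ) ≤ 1 := by
    rw [← Matrix.diagonal_one]
    exact specNorm_diagonal_le zero_le_one (by simp)
  rw [← hU, specNorm_transpose_mul_self] at h
  nlinarith [specNorm_nonneg U]

theorem specNorm_mul_mul_le {A : Matrix (Fin m) (Fin n) ℝ} {B : Matrix (Fin n) (Fin p) ℝ}
    {C : Matrix (Fin p) (Fin q) ℝ} (hA : specNorm A ≤ 1) (hC : specNorm C ≤ 1) :
    specNorm (A * B * C) ≤ specNorm B := by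
  have hAB : specNorm (A * B) ≤ specNorm B :=
    (specNorm_mul_le A B).trans (mul_le_of_le_one_left (specNorm_nonneg B) hA)
  exact (specNorm_mul_le _ C).trans
    ((mul_le_of_le_one_right (specNorm_nonneg _) hC).trans hAB)

theorem rectDiag_eq_sum (d : EuclideanSpace ℝ (Fin (min p q))) :
    rectDiag d = ∑ k, Matrix.single (Fin.castLE (min_le_left p q) k)
      (Fin.castLE (min_le_right p q) k) (d k) := by
  ext i j
  rw [Matrix.sum_apply]
  simp only [rectDiag, Matrix.of_apply, Matrix.single_apply, Fin.ext_iff, Fin.val_castLE]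
  split_ifs with h
  · rw [Finset.sum_eq_single ⟨i, lt_min i.isLt (h ▸ j.isLt)⟩]
    · simp [h]
    · intro k _ hk
      exact if_neg fun hki => hk (Fin.ext hki.1)
    · simp
  · exact (Finset.sum_eq_zero fun k _ => if_neg fun hk => h (hk.1.symm.trans hk.2)).symm

theorem trace_rectDiag_transpose_mul (d : EuclideanSpace ℝ (Fin (min p q)))
    (A : Matrix (Fin p) (Fin q) ℝ) :
    ((rectDiag d)ᵀ * A).trace =
      ∑ k, d k * A (Fin.castLE (min_le_left p q) k) (Fin.castLE (min_le_right p q) k) := by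
  rw [rectDiag_eq_sum, Matrix.transpose_sum, Matrix.sum_mul, Matrix.trace_sum]
  simp [Matrix.transpose_single, Matrix.trace_single_mul]

theorem rectDiag_castLE (d : EuclideanSpace ℝ (Fin (min p q))) (k : Fin (min p q)) :
    rectDiag d (Fin.castLE (min_le_left p q) k) (Fin.castLE (min_le_right p q) k) = d k := by
  simp [rectDiag]

theorem rectDiag_sub_smul (d e : EuclideanSpace ℝ (Fin (min p q))) (c : ℝ) :
    rectDiag (d - c • e) = rectDiag d - c • rectDiag e := by
  ext i j
  by_cases h : (i : ℕ) = j <;> simp [rectDiag, h]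

/-- The identity `‖DᵀD‖ = ‖D‖²` reduces the rectangular case to a square diagonal matrix, with zeros
in the positions `j ≥ p`. -/
theorem specNorm_rectDiag_le {d : EuclideanSpace ℝ (Fin (min p q))} {c : ℝ} (hc : 0 ≤ c)
    (hd : ∀ i, |d i| ≤ c) : specNorm (rectDiag d) ≤ c := by
  have hmul : (rectDiag d)ᵀ * rectDiag d = Matrix.diagonal fun j : Fin q =>
      if h : (j : ℕ) < p then d ⟨j, lt_min h j.isLt⟩ ^ 2 else 0 := by
    ext i j
    rw [Matrix.mul_apply, Matrix.diagonal_apply]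
    simp only [Matrix.transpose_apply, rectDiag, Matrix.of_apply]
    by_cases hi : (i : ℕ) < p
    · rw [Finset.sum_eq_single ⟨i, hi⟩]
      · by_cases hij : i = j
        · subst hij
          simp [hi, sq]
        · simp [hij, Fin.val_ne_of_ne hij]
      · intro k _ hk
        rw [dif_neg fun hki => hk (Fin.ext hki), zero_mul]
      · simp
    · rw [dif_neg hi, ite_self]
      refine Finset.sum_eq_zero fun k _ => ?_
      rw [dif_neg fun hki : (k : ℕ) = i => hi (hki ▸ k.isLt), zero_mul]
  have h : specNorm ((rectDiag d)ᵀ * rectDiag d) ≤ c ^ 2 := by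
    rw [hmul]
    refine specNorm_diagonal_le (sq_nonneg c) fun j => ?_
    split_ifs with hj
    · rw [abs_pow]
      exact pow_le_pow_left₀ (abs_nonneg _) (hd _) 2
    · simpa using sq_nonneg c
  rw [specNorm_transpose_mul_self, ← sq] at h
  exact le_of_sq_le_sq h hc

theorem convex_l1Ball : Convex ℝ (l1Ball r) := by
  intro x hx y hy a b ha hb hab
  simp only [l1Ball, Set.mem_ofPred_eq] at hx hy ⊢
  calc ∑ i, |(a • x + b • y) i| ≤ ∑ i, (a * |x i| + b * |y i|) := by
        refine Finset.sum_le_sum fun i _ => ?_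
        have := abs_add_le (a * x i) (b * y i)
        rw [abs_mul, abs_mul, abs_of_nonneg ha, abs_of_nonneg hb] at this
        simpa using this
    _ = a * ∑ i, |x i| + b * ∑ i, |y i| := by
        rw [Finset.sum_add_distrib, Finset.mul_sum, Finset.mul_sum]
    _ ≤ 1 := by nlinarith

theorem l1Proj_mem (v : EuclideanSpace ℝ (Fin r)) : l1Proj v ∈ l1Ball r :=
  (existsUnique_l1Proj v).choose_spec.1.1

theorem norm_sub_l1Proj_le (v : EuclideanSpace ℝ (Fin r)) {y : EuclideanSpace ℝ (Fin r)}
    (hy : y ∈ l1Ball r) : ‖v - l1Proj v‖ ≤ ‖v - y‖ :=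
  (existsUnique_l1Proj v).choose_spec.1.2 y hy

theorem inner_sub_l1Proj_le (v : EuclideanSpace ℝ (Fin r)) {y : EuclideanSpace ℝ (Fin r)}
    (hy : y ∈ l1Ball r) : inner ℝ (v - l1Proj v) (y - l1Proj v) ≤ 0 := by
  refine (norm_eq_iInf_iff_real_inner_le_zero convex_l1Ball (l1Proj_mem v)).1 ?_ y hy
  have : Nonempty (l1Ball r) := ⟨⟨_, l1Proj_mem v⟩⟩
  exact le_antisymm (le_ciInf fun w => norm_sub_l1Proj_le v w.2)
    (ciInf_le ⟨0, Set.forall_mem_range.2 fun _ => norm_nonneg _⟩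
      (⟨l1Proj v, l1Proj_mem v⟩ : l1Ball r))

theorem inner_sub_smul_l1Proj_le {lam : ℝ} (hlam : 0 < lam) (σ : EuclideanSpace ℝ (Fin r))
    {y : EuclideanSpace ℝ (Fin r)} (hy : y ∈ l1Ball r) :
    inner ℝ (σ - lam • l1Proj (lam⁻¹ • σ)) y ≤
      inner ℝ (σ - lam • l1Proj (lam⁻¹ • σ)) (l1Proj (lam⁻¹ • σ)) := by
  have h := mul_nonpos_of_nonneg_of_nonpos hlam.le (inner_sub_l1Proj_le (lam⁻¹ • σ) hy)
  rw [← real_inner_smul_left, smul_sub, smul_inv_smul₀ hlam.ne', inner_sub_right] at h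
  linarith

/-- The projection maximizes the linear form given by the residual over the ℓ¹ ball; comparing with
the vertices `±eᵢ` bounds the sup norm of the residual. -/
theorem abs_sub_smul_l1Proj_le {lam : ℝ} (hlam : 0 < lam) (σ : EuclideanSpace ℝ (Fin r))
    (i : Fin r) : |(σ - lam • l1Proj (lam⁻¹ • σ)) i| ≤
      inner ℝ (σ - lam • l1Proj (lam⁻¹ • σ)) (l1Proj (lam⁻¹ • σ)) := by
  have hmem (a : ℝ) (ha : |a| ≤ 1) : EuclideanSpace.single i a ∈ l1Ball r := by
    simpa [l1Ball, Pi.single_apply, apply_ite abs] using ha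
  have h1 := inner_sub_smul_l1Proj_le hlam σ (hmem 1 (by simp))
  have h2 := inner_sub_smul_l1Proj_le hlam σ (hmem (-1) (by simp))
  rw [EuclideanSpace.inner_single_right] at h1 h2
  simp only [one_mul, neg_mul, conj_trivial] at h1 h2
  exact abs_le.2 ⟨by linarith, h1⟩

/-- The trace only sees the diagonal of `Uᵀ * X * V`, weighted by `d`; each entry is at most `‖X‖₂`
in absolute value, since `U` and `V` are contractions. -/
theorem trace_transpose_mul_le_specNorm {U : Matrix (Fin m) (Fin p) ℝ}
    {V : Matrix (Fin n) (Fin q) ℝ} (hU : Uᵀ * U = 1) (hV : Vᵀ * V = 1)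
    {d : EuclideanSpace ℝ (Fin (min p q))} (hd : d ∈ l1Ball (min p q))
    (X : Matrix (Fin m) (Fin n) ℝ) :
    ((U * rectDiag d * Vᵀ)ᵀ * X).trace ≤ specNorm X := by
  have htr : ((U * rectDiag d * Vᵀ)ᵀ * X).trace = ((rectDiag d)ᵀ * (Uᵀ * X * V)).trace := by
    rw [Matrix.transpose_mul, Matrix.transpose_mul, Matrix.transpose_transpose,
      Matrix.mul_assoc V, Matrix.trace_mul_comm]
    simp only [Matrix.mul_assoc]
  have hle : specNorm (Uᵀ * X * V) ≤ specNorm X :=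
    specNorm_mul_mul_le ((specNorm_transpose U).trans_le
      (specNorm_le_one_of_transpose_mul_self hU)) (specNorm_le_one_of_transpose_mul_self hV)
  rw [htr, trace_rectDiag_transpose_mul]
  calc _ ≤ ∑ k, |d k| * specNorm X := by
        refine Finset.sum_le_sum fun k _ => (le_abs_self _).trans ?_
        rw [abs_mul]
        exact mul_le_mul_of_nonneg_left ((abs_apply_le_specNorm _ _ _).trans hle) (abs_nonneg _)
    _ = (∑ k, |d k|) * specNorm X := (Finset.sum_mul _ _ _).symm
    _ ≤ specNorm X := mul_le_of_le_one_left (specNorm_nonneg X) hd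

theorem trace_transpose_mul_svd {U : Matrix (Fin m) (Fin p) ℝ}
    {V : Matrix (Fin n) (Fin q) ℝ} (hU : Uᵀ * U = 1) (hV : Vᵀ * V = 1)
    (d e : EuclideanSpace ℝ (Fin (min p q))) :
    ((U * rectDiag d * Vᵀ)ᵀ * (U * rectDiag e * Vᵀ)).trace = inner ℝ e d := by
  have h : (U * rectDiag d * Vᵀ)ᵀ * (U * rectDiag e * Vᵀ) =
      V * ((rectDiag d)ᵀ * (Uᵀ * U) * rectDiag e * Vᵀ) := by
    simp only [Matrix.transpose_mul, Matrix.transpose_transpose, Matrix.mul_assoc]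
  rw [h, Matrix.trace_mul_comm, Matrix.mul_assoc, hV, hU, Matrix.mul_one, Matrix.mul_one,
    trace_rectDiag_transpose_mul]
  simp [rectDiag_castLE, PiLp.inner_apply]

theorem objective_add_le {Y : Matrix (Fin m) (Fin n) ℝ} {lam : ℝ} (hlam : 0 < lam)
    {U : Matrix (Fin m) (Fin p) ℝ} {σ : EuclideanSpace ℝ (Fin (min p q))}
    {V : Matrix (Fin n) (Fin q) ℝ} (hY : IsSVD Y U σ V) (X : Matrix (Fin m) (Fin n) ℝ) :
    objective Y lam (U * rectDiag (σ - lam • l1Proj (lam⁻¹ • σ)) * Vᵀ) +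
      1 / 2 * frobNorm (X - U * rectDiag (σ - lam • l1Proj (lam⁻¹ • σ)) * Vᵀ) ^ 2 ≤
      objective Y lam X := by
  have hU := hY.orthonormal_left
  have hV := hY.orthonormal_right
  set d := l1Proj (lam⁻¹ • σ) with hd
  set Z := U * rectDiag (σ - lam • d) * Vᵀ with hZ
  have hYZ : Y - Z = lam • (U * rectDiag d * Vᵀ) := by
    rw [hZ, rectDiag_sub_smul, Matrix.mul_sub, Matrix.sub_mul, ← hY.eq_mul, sub_sub_cancel,
      Matrix.mul_smul, Matrix.smul_mul]
  have hX : ((U * rectDiag d * Vᵀ)ᵀ * X).trace ≤ specNorm X :=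
    trace_transpose_mul_le_specNorm hU hV (l1Proj_mem _) X
  have hnonneg : 0 ≤ inner ℝ (σ - lam • d) d := by
    have h := inner_sub_smul_l1Proj_le hlam σ (y := 0) (by simp [l1Ball])
    rwa [inner_zero_right] at h
  have hZnorm : specNorm Z ≤ ((U * rectDiag d * Vᵀ)ᵀ * Z).trace := by
    rw [trace_transpose_mul_svd hU hV]
    exact (specNorm_mul_mul_le (specNorm_le_one_of_transpose_mul_self hU)
      ((specNorm_transpose V).trans_le (specNorm_le_one_of_transpose_mul_self hV))).trans
      (specNorm_rectDiag_le hnonneg (abs_sub_smul_l1Proj_le hlam σ))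
  have hinner : ((Y - Z)ᵀ * (Z - X)).trace = lam * (((U * rectDiag d * Vᵀ)ᵀ * Z).trace -
      ((U * rectDiag d * Vᵀ)ᵀ * X).trace) := by
    rw [hYZ, Matrix.transpose_smul, Matrix.smul_mul, Matrix.trace_smul, Matrix.mul_sub,
      Matrix.trace_sub, smul_eq_mul]
  rw [objective, objective, frobNorm_sub_sq Y X Z, hinner]
  -- The cross term is at least `lam * (‖Z‖₂ - ‖X‖₂)`.
  nlinarith [mul_le_mul_of_nonneg_left hX hlam.le, mul_le_mul_of_nonneg_left hZnorm hlam.le]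

end SpectralProx

theorem mainTheorem2 {m n p q : ℕ} (Y : Matrix (Fin m) (Fin n) ℝ) (lam : ℝ) (hlam : 0 < lam)
    (U : Matrix (Fin m) (Fin p) ℝ) (σ : EuclideanSpace ℝ (Fin (min p q)))
    (V : Matrix (Fin n) (Fin q) ℝ) (hY : SpectralProx.IsSVD Y U σ V)
    (X : Matrix (Fin m) (Fin n) ℝ) :
    IsMinOn (SpectralProx.objective Y lam) Set.univ X ↔
      X = U * SpectralProx.rectDiag (σ - lam • SpectralProx.l1Proj (lam⁻¹ • σ)) * V.transpose := by
  constructor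
  · intro h
    have hle := isMinOn_iff.1 h _ (Set.mem_univ (U * SpectralProx.rectDiag
      (σ - lam • SpectralProx.l1Proj (lam⁻¹ • σ)) * V.transpose))
    have hadd := SpectralProx.objective_add_le hlam hY X
    refine sub_eq_zero.1 (SpectralProx.eq_zero_of_frobNorm_eq_zero (pow_eq_zero_iff two_ne_zero
      |>.1 (le_antisymm ?_ (sq_nonneg _))))
    linarith
  · rintro rfl
    refine isMinOn_iff.2 fun Z _ => ?_
    have hadd := SpectralProx.objective_add_le hlam hY Z
    exact le_trans (le_add_of_nonneg_right (by positivity)) hadd
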